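/- For a Boolean function $f:\{0,1\}^n\to\{0,1\}$ let $\hat f(a)=2^{-n}\sum_x(-1)^{f(x)\oplus x\cdot a}$ be its Walsh coefficients and $\hat f_{\max}=\max_a|\hat f(a)|$; $f$ is bent if $|\hat f(a)|=2^{-n/2}$ for all $a$. A quantum query algorithm accesses $f$ only through the unitary $|x,b,w\rangle\mapsto|x,b\oplus f(x),w\rangle$: it starts in a fixed basis state, interleaves queries with unitaries independent of $f$ on a finite-dimensional space, and finally measures in the computational basis and outputs a bit determined by the outcome. (1) $\hat f_{\max}=2^{-n/2}$ if and only if $f$ is bent, and for every even $n$ there is a bent function $f$ on $\{0,1\}^n$ with $\hat f(0^n)=2^{-n/2}$. (2) Let $f$ be bent with $\hat f(0^n)=2^{-n/2}$, and let $\lambda>0$ be such that $k=2\lambda\cdot 2^n$ is an integer not larger than the number of ones in the truth table of $f$. Let $Y_{f,\lambda}$ be the set of functions obtained from $f$ by flipping exactly $k$ ones of its truth table to zero. Then $Y_{f,\lambda}\ne\emptyset$, and $\hat g_{\max}=2^{-n/2}+4\lambda$ for every $g\in Y_{f,\lambda}$. (3) For every $\varepsilon\in[0,\tfrac12)$ there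 is a constant $c>0$, depending only on $\varepsilon$, such that the following hold. (a) Let $n\ge 0$ and $\lambda>0$ be such that there is an $n$-bit function $f$ with $\hat f_{\max}=2^{-n/2}$ and an $n$-bit function $g$ with $\hat g_{\max}=2^{-n/2}+4\lambda$. Then every quantum query algorithm that, given the oracle of an $n$-bit function $f$ with the promise that $\hat f_{\max}=2^{-n/2}$ or $\hat f_{\max}=2^{-n/2}+4\lambda$, decides which is the case with error probability at most $\varepsilon$, makes at least $c/\sqrt\lambda$ queries. (b) For $f$ and $\lambda$ as in (2), every quantum query algorithm that decides with error probability at most $\varepsilon$ whether its input is $f$ or belongs to $Y_{f,\lambda}$, given the promise that one of these is the case, makes at least $c/\sqrt\lambda$ queries. -/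

import Mathlib

open scoped Classical

noncomputable section

/-- The cube of `n`-bit strings, as the vector space of dimension `n` over the field `ZMod 2`. -/
abbrev Cube (n : ℕ) : Type := Fin n → ZMod 2

/-- Boolean functions with `n` input bits and one output bit (equivalently, truth tables). -/
abbrev BoolFun (n : ℕ) : Type := Cube n → ZMod 2

/-- The normalised Walsh coefficient `2⁻ⁿ ∑ₓ (-1) ^ (f(x) ⊕ x·a)`. -/
def walsh {n : ℕ} (f : BoolFun n) (a : Cube n) : ℝ :=
  (1 / (2 : ℝ) ^ n) * ∑ x : Cube n, (-1 : ℝ) ^ (f x + x ⬝ᵥ a).val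

/-- The largest absolute value of a Walsh coefficient. -/
def walshMax {n : ℕ} (f : BoolFun n) : ℝ :=
  Finset.univ.sup' Finset.univ_nonempty (fun a : Cube n => |walsh f a|)

/-- All Walsh coefficients have absolute value `1 / √(2ⁿ)`. -/
def IsBent {n : ℕ} (f : BoolFun n) : Prop :=
  ∀ a : Cube n, |walsh f a| = 1 / √((2 : ℝ) ^ n)

/-- Hamming weight of the truth table. -/
def weight {n : ℕ} (f : BoolFun n) : ℕ :=
  (Finset.univ.filter (fun x : Cube n => f x = 1)).card

/-- The functions obtained from `f` by flipping exactly `k` ones of its truth table to zero. -/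
def flips {n : ℕ} (f : BoolFun n) (k : ℕ) : Set (BoolFun n) :=
  {g | ∃ S : Finset (Cube n), S.card = k ∧ (∀ x ∈ S, f x = 1) ∧
    ∀ x, g x = if x ∈ S then 0 else f x}

/-- The permutation `(x, b, w) ↦ (x, b ⊕ f(x), w)` of the computational basis. -/
def oraclePerm {n : ℕ} (W : Type) (f : BoolFun n) :
    Equiv.Perm (Cube n × ZMod 2 × W) where
  toFun z := (z.1, z.2.1 + f z.1, z.2.2)
  invFun z := (z.1, z.2.1 - f z.1, z.2.2)
  left_inv z := by simp
  right_inv z := by simp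

/-- The query unitary, sending `|x, b, w⟩` to `|x, b ⊕ f(x), w⟩`. -/
def oracle {n : ℕ} (W : Type) [Fintype W] (f : BoolFun n) :
    EuclideanSpace ℂ (Cube n × ZMod 2 × W) ≃ₗᵢ[ℂ] EuclideanSpace ℂ (Cube n × ZMod 2 × W) :=
  LinearIsometryEquiv.piLpCongrLeft 2 ℂ ℂ (oraclePerm W f)

/-- The query unitary acts on computational basis states as stated. -/
theorem oracle_single {n : ℕ} (W : Type) [Fintype W] (f : BoolFun n)
    (x : Cube n) (b : ZMod 2) (w : W) :
    oracle W f (EuclideanSpace.single (x, b, w) 1) =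
      EuclideanSpace.single (x, b + f x, w) 1 := by
  have h := EuclideanSpace.piLpCongrLeft_single (𝕜 := ℂ) (oraclePerm W f) (x, b, w) (1 : ℂ)
  exact h

/-- A quantum query algorithm for `n`-bit Boolean functions with a binary answer. The registers
are an `n`-bit query register, an answer bit, and a work space of arbitrary finite dimension
with basis `W`. The algorithm starts in a basis state, applies unitaries that do not depend on
the input function, interleaved with `queries` calls to the oracle, finally measures in the
computational basis and outputs a bit computed from the outcome. Only the unitaries with index
`0, …, queries` are used. -/
structure QueryAlgorithm (n : ℕ) where
  W : Type
  [fintypeW : Fintype W]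
  queries : ℕ
  start : Cube n × ZMod 2 × W
  unitary : ℕ →
    (EuclideanSpace ℂ (Cube n × ZMod 2 × W) ≃ₗᵢ[ℂ] EuclideanSpace ℂ (Cube n × ZMod 2 × W))
  output : Cube n × ZMod 2 × W → Bool

attribute [instance] QueryAlgorithm.fintypeW

namespace QueryAlgorithm

variable {n : ℕ}

/-- The state `Uⱼ O_f Uⱼ₋₁ ⋯ U₁ O_f U₀ |start⟩`, after `j` queries to `f`. -/
def state (A : QueryAlgorithm n) (f : BoolFun n) :
    ℕ → EuclideanSpace ℂ (Cube n × ZMod 2 × A.W)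
  | 0 => A.unitary 0 (EuclideanSpace.single A.start 1)
  | j + 1 => A.unitary (j + 1) (oracle A.W f (A.state f j))

/-- The probability that the algorithm, run on the oracle of `f`, outputs the bit `b`. -/
def prob (A : QueryAlgorithm n) (f : BoolFun n) (b : Bool) : ℝ :=
  ∑ z ∈ Finset.univ.filter (fun z => A.output z = b), ‖A.state f A.queries z‖ ^ 2

/-- Under the promise that the input is in `X` or in `Y`, the algorithm decides which is the
case (answering `true` for `X` and `false` for `Y`) with probability of error at most `ε`. -/
def Decides (A : QueryAlgorithm n) (ε : ℝ) (X Y : Set (BoolFun n)) : Prop :=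
  (∀ f ∈ X, 1 - ε ≤ A.prob f true) ∧ (∀ f ∈ Y, 1 - ε ≤ A.prob f false)

end QueryAlgorithm

end

open scoped Classical

noncomputable section

/-! ### Signs and the Walsh transform -/

/-! By Parseval (`sum_sq_walsh`) the squared Walsh coefficients average 2⁻ⁿ, so their maximum
attains this value only if all are equal: the bent case. Flipping a set S of k ones adds (2/2ⁿ) ∑_{x
∈ S} (-1)^(x·a) to the coefficient at a (`walsh_flip`). This is at most 2k/2ⁿ = 4λ in absolute
value, with equality at a = 0.

The lower bound is a hybrid argument. A run of T queries on f has total query mass T, so among the M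
ones of f some k carry mass at most kT/M. Flipping these moves the final state by at most 2T√(k/M),
which must be of constant order. Since M ≥ 2ⁿ/8 and k = 2λ2ⁿ, T is of order at least 1/√λ. The
general promise problem contains such an instance by complementation and integrality
(`exists_flip_count`). -/

/-- The sign `(-1) ^ a` of a bit. -/
def bitSign (a : ZMod 2) : ℝ := (-1 : ℝ) ^ a.val

theorem zmod_two_cases (a : ZMod 2) : a = 0 ∨ a = 1 := by
  revert a; decide

theorem bitSign_zero : bitSign 0 = 1 := by simp [bitSign]

theorem bitSign_one : bitSign 1 = -1 := by
  have h : (1 : ZMod 2).val = 1 := rfl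
  simp [bitSign, h]

theorem bitSign_add (a b : ZMod 2) : bitSign (a + b) = bitSign a * bitSign b := by
  have h : (1 : ZMod 2) + 1 = 0 := rfl
  rcases zmod_two_cases a with rfl | rfl <;> rcases zmod_two_cases b with rfl | rfl <;>
    simp [bitSign_zero, bitSign_one, h]

theorem bitSign_mul_self (a : ZMod 2) : bitSign a * bitSign a = 1 := by
  rcases zmod_two_cases a with rfl | rfl <;> simp [bitSign_zero, bitSign_one]

theorem abs_bitSign (a : ZMod 2) : |bitSign a| = 1 := by
  rcases zmod_two_cases a with rfl | rfl <;> simp [bitSign_zero, bitSign_one]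

theorem cube_add_eq_zero_iff {n : ℕ} (x y : Cube n) : x + y = 0 ↔ x = y := by
  rw [add_eq_zero_iff_eq_neg]
  have : -y = y := funext fun i => CharTwo.neg_eq (y i)
  rw [this]

theorem card_cube (n : ℕ) : Fintype.card (Cube n) = 2 ^ n := by
  simp [Cube, ZMod.card]

theorem walsh_eq {n : ℕ} (f : BoolFun n) (a : Cube n) :
    walsh f a = (1 / (2 : ℝ) ^ n) * ∑ x : Cube n, bitSign (f x + x ⬝ᵥ a) := rfl

theorem sum_bitSign_dotProduct {n : ℕ} (u : Cube n) :
    ∑ a : Cube n, bitSign (u ⬝ᵥ a) = if u = 0 then (2 : ℝ) ^ n else 0 := by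
  split_ifs with h
  · subst h
    simp [bitSign_zero, ZMod.card]
  · obtain ⟨i, hi⟩ := Function.ne_iff.mp h
    have hi1 : u i = 1 := (zmod_two_cases (u i)).resolve_left hi
    -- Translation by the `i`-th basis vector negates every summand, so the sum vanishes.
    have key := Equiv.sum_comp (Equiv.addRight (Pi.single i 1 : Cube n))
      (fun a : Cube n => bitSign (u ⬝ᵥ a))
    simp only [Equiv.coe_addRight, dotProduct_add, dotProduct_single, hi1, mul_one, bitSign_add,
      bitSign_one, mul_neg, Finset.sum_neg_distrib] at key
    linarith

theorem sum_sq_walsh {n : ℕ} (f : BoolFun n) : ∑ a : Cube n, walsh f a ^ 2 = 1 := by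
  have hN : (2 : ℝ) ^ n ≠ 0 := by positivity
  have h1 : ∀ a : Cube n, walsh f a ^ 2 = (1 / (2 : ℝ) ^ n) ^ 2 *
      ∑ x : Cube n, ∑ y : Cube n, bitSign (f x + f y) * bitSign ((x + y) ⬝ᵥ a) := by
    intro a
    rw [walsh_eq, mul_pow, sq (∑ x : Cube n, _), Finset.sum_mul_sum]
    congr 1
    refine Finset.sum_congr rfl fun x _ => Finset.sum_congr rfl fun y _ => ?_
    simp only [bitSign_add, add_dotProduct]
    ring
  have h2 : ∀ x : Cube n,
      ∑ y : Cube n, ∑ a : Cube n, bitSign (f x + f y) * bitSign ((x + y) ⬝ᵥ a) = 2 ^ n := by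
    intro x
    have hxy : ∀ y : Cube n, (x + y = 0) ↔ y = x := by
      intro y
      rw [cube_add_eq_zero_iff, eq_comm]
    simp_rw [← Finset.mul_sum, sum_bitSign_dotProduct, hxy]
    simp [bitSign_add, bitSign_mul_self]
  simp_rw [h1, ← Finset.mul_sum]
  rw [Finset.sum_comm]
  simp_rw [fun x : Cube n => Finset.sum_comm (s := (Finset.univ : Finset (Cube n)))
    (t := (Finset.univ : Finset (Cube n)))
    (f := fun a y => bitSign (f x + f y) * bitSign ((x + y) ⬝ᵥ a)), h2]
  simp only [Finset.sum_const, Finset.card_univ, card_cube, nsmul_eq_mul, Nat.cast_pow,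
    Nat.cast_ofNat]
  field_simp

theorem abs_walsh_le_walshMax {n : ℕ} (f : BoolFun n) (a : Cube n) :
    |walsh f a| ≤ walshMax f :=
  Finset.le_sup' (fun a : Cube n => |walsh f a|) (Finset.mem_univ a)

theorem exists_abs_walsh_eq_walshMax {n : ℕ} (f : BoolFun n) :
    ∃ a : Cube n, walshMax f = |walsh f a| := by
  obtain ⟨a, -, ha⟩ := Finset.exists_mem_eq_sup' (Finset.univ_nonempty (α := Cube n))
    (fun a : Cube n => |walsh f a|)
  exact ⟨a, ha⟩

/-- Each square is at most 2⁻ⁿ and their sum is 1, so every termwise bound is an equality. -/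
theorem walshMax_eq_iff_isBent {n : ℕ} (f : BoolFun n) :
    walshMax f = 1 / √((2 : ℝ) ^ n) ↔ IsBent f := by
  constructor
  · intro h
    have hle : ∀ a : Cube n, walsh f a ^ 2 ≤ 1 / 2 ^ n := by
      intro a
      have h1 := abs_walsh_le_walshMax f a
      rw [h] at h1
      calc walsh f a ^ 2 = |walsh f a| ^ 2 := (sq_abs _).symm
        _ ≤ (1 / √((2 : ℝ) ^ n)) ^ 2 := by gcongr
        _ = 1 / 2 ^ n := by rw [div_pow, Real.sq_sqrt (by positivity), one_pow]
    have hsum : ∑ a : Cube n, walsh f a ^ 2 = ∑ _a : Cube n, (1 / 2 ^ n : ℝ) := by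
      rw [sum_sq_walsh]
      simp [ZMod.card]
    have heq := (Finset.sum_eq_sum_iff_of_le (fun a _ => hle a)).mp hsum
    intro a
    rw [← Real.sqrt_sq_eq_abs, heq a (Finset.mem_univ a), Real.sqrt_div zero_le_one,
      Real.sqrt_one]
  · intro h
    obtain ⟨a, ha⟩ := exists_abs_walsh_eq_walshMax f
    rw [ha, h a]

/-! ### Inner product functions -/

/-- The inner product of the two halves of the input. -/
def halvesDot (m : ℕ) : BoolFun (m + m) :=
  fun x => (fun i => x (Fin.castAdd m i)) ⬝ᵥ fun i => x (Fin.natAdd m i)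

/-- With x = (y, z) and a = (p, q) the exponent is y·p + (y + q)·z; summing over z leaves only y =
q. -/
theorem walsh_halvesDot {m : ℕ} (a : Cube (m + m)) :
    walsh (halvesDot m) a = 1 / √((2 : ℝ) ^ (m + m)) *
      bitSign ((fun i => a (Fin.natAdd m i)) ⬝ᵥ fun i => a (Fin.castAdd m i)) := by
  have hsqrt : √((2 : ℝ) ^ (m + m)) = 2 ^ m := by
    rw [pow_add, Real.sqrt_mul_self (by positivity)]
  set p : Cube m := fun i => a (Fin.castAdd m i) with hp
  set q : Cube m := fun i => a (Fin.natAdd m i) with hq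
  have key : ∑ x : Cube (m + m), bitSign (halvesDot m x + x ⬝ᵥ a) = 2 ^ m * bitSign (q ⬝ᵥ p) := by
    rw [← Equiv.sum_comp (Fin.appendEquiv m m), Fintype.sum_prod_type]
    have h1 : ∀ y z : Cube m,
        bitSign (halvesDot m (Fin.appendEquiv m m (y, z)) + Fin.appendEquiv m m (y, z) ⬝ᵥ a) =
          bitSign (y ⬝ᵥ p) * bitSign ((y + q) ⬝ᵥ z) := by
      intro y z
      rw [← bitSign_add]
      congr 1
      simp only [halvesDot, Fin.appendEquiv, Equiv.coe_fn_mk, dotProduct, Fin.sum_univ_add,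
        Fin.append_left, Fin.append_right, Pi.add_apply, add_mul, Finset.sum_add_distrib, hp, hq]
      simp only [mul_comm (z _)]
      ring
    simp_rw [h1, ← Finset.mul_sum, sum_bitSign_dotProduct, cube_add_eq_zero_iff]
    simp [mul_comm]
  rw [walsh_eq, key, hsqrt, pow_add]
  field_simp

theorem exists_isBent_of_even {n : ℕ} (hn : Even n) :
    ∃ f : BoolFun n, IsBent f ∧ walsh f 0 = 1 / √((2 : ℝ) ^ n) := by
  obtain ⟨m, rfl⟩ := hn
  refine ⟨halvesDot m, fun a => ?_, ?_⟩
  · rw [walsh_halvesDot, abs_mul, abs_bitSign, mul_one, abs_of_nonneg (by positivity)]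
  · rw [walsh_halvesDot]
    simp [dotProduct, bitSign_zero]

/-! ### Flipping ones to zeros -/

theorem flips_nonempty {n : ℕ} (f : BoolFun n) {k : ℕ} (hk : k ≤ weight f) :
    (flips f k).Nonempty := by
  obtain ⟨S, hS, hc⟩ := Finset.exists_subset_card_eq hk
  exact ⟨fun x => if x ∈ S then 0 else f x, S, hc,
    fun x hx => (Finset.mem_filter.mp (hS hx)).2, fun x => rfl⟩

theorem walsh_flip {n : ℕ} {f g : BoolFun n} {S : Finset (Cube n)} (hS : ∀ x ∈ S, f x = 1)
    (hg : ∀ x, g x = if x ∈ S then 0 else f x) (a : Cube n) :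
    walsh g a = walsh f a + 2 / 2 ^ n * ∑ x ∈ S, bitSign (x ⬝ᵥ a) := by
  have h : ∀ x, bitSign (g x + x ⬝ᵥ a) = bitSign (f x + x ⬝ᵥ a) +
      if x ∈ S then 2 * bitSign (x ⬝ᵥ a) else 0 := by
    intro x
    rw [hg x]
    split_ifs with hx
    · rw [hS x hx, bitSign_add, bitSign_add, bitSign_zero, bitSign_one]
      ring
    · rw [add_zero]
  simp only [walsh_eq, h, Finset.sum_add_distrib, Finset.sum_ite_mem, Finset.univ_inter,
    ← Finset.mul_sum]
  ring

theorem walshMax_of_mem_flips {n : ℕ} {lam : ℝ} {f g : BoolFun n} {k : ℕ} (hf : IsBent f)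
    (hf0 : walsh f 0 = 1 / √((2 : ℝ) ^ n)) (hk : (k : ℝ) = 2 * lam * 2 ^ n)
    (hg : g ∈ flips f k) : walshMax g = 1 / √((2 : ℝ) ^ n) + 4 * lam := by
  obtain ⟨S, hc, hS, hgS⟩ := hg
  have hlam : 2 / 2 ^ n * (S.card : ℝ) = 4 * lam := by
    rw [hc, hk]
    field_simp
    ring
  apply le_antisymm
  · refine Finset.sup'_le _ _ fun a _ => ?_
    rw [walsh_flip hS hgS a, ← hf a, ← hlam]
    refine (abs_add_le _ _).trans ?_
    rw [abs_mul, abs_of_nonneg (by positivity : (0 : ℝ) ≤ 2 / 2 ^ n)]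
    gcongr
    refine (Finset.abs_sum_le_sum_abs _ _).trans ?_
    simp [abs_bitSign]
  -- At a = 0 all signs are +1 and the coefficient of f is positive, so nothing cancels.
  · refine le_trans (le_of_eq ?_) ((le_abs_self _).trans (abs_walsh_le_walshMax g 0))
    rw [walsh_flip hS hgS 0, hf0]
    simp [bitSign_zero, ← hlam]

/-! ### Weights and integrality -/

theorem bitSign_eq_one_sub (a : ZMod 2) : bitSign a = 1 - 2 * if a = 1 then 1 else 0 := by
  rcases zmod_two_cases a with rfl | rfl
  · simp [bitSign_zero]
  · norm_num [bitSign_one]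

theorem walsh_eq_one_sub_card {n : ℕ} (f : BoolFun n) (a : Cube n) :
    walsh f a = 1 - 2 * ((Finset.univ.filter fun x : Cube n => f x + x ⬝ᵥ a = 1).card : ℝ) /
      2 ^ n := by
  rw [walsh_eq]
  simp only [bitSign_eq_one_sub, Finset.sum_sub_distrib, ← Finset.mul_sum, Finset.sum_boole,
    Finset.sum_const, Finset.card_univ, card_cube]
  simp
  field_simp

theorem walsh_zero_eq_one_sub_weight {n : ℕ} (f : BoolFun n) :
    walsh f 0 = 1 - 2 * (weight f : ℝ) / 2 ^ n := by
  rw [walsh_eq_one_sub_card]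
  simp [weight]

theorem walsh_add_one {n : ℕ} (f : BoolFun n) (a : Cube n) :
    walsh (fun x => f x + 1) a = -walsh f a := by
  simp only [walsh_eq, bitSign_add, bitSign_one]
  simp

/-- The absolute values of all Walsh coefficients, multiplied by `2 ^ n`, are integers of the
same parity as `2 ^ n`. -/
theorem exists_abs_walsh_eq {n : ℕ} (f : BoolFun n) (a : Cube n) :
    ∃ d : ℤ, |walsh f a| = 1 - 2 * (d : ℝ) / 2 ^ n := by
  rcases abs_choice (walsh f a) with h | h
  · exact ⟨(Finset.univ.filter fun x : Cube n => f x + x ⬝ᵥ a = 1).card, by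
      rw [h, walsh_eq_one_sub_card]; simp⟩
  · exact ⟨(Finset.univ.filter fun x : Cube n => (f x + 1) + x ⬝ᵥ a = 1).card, by
      rw [h, ← walsh_add_one, walsh_eq_one_sub_card]; simp⟩

theorem abs_walsh_le_one {n : ℕ} (f : BoolFun n) (a : Cube n) : |walsh f a| ≤ 1 := by
  rw [← sq_le_one_iff_abs_le_one, ← sum_sq_walsh f]
  exact Finset.single_le_sum (f := fun a => walsh f a ^ 2) (fun _ _ => sq_nonneg _)
    (Finset.mem_univ a)

theorem IsBent.exists_walsh_zero {n : ℕ} {f : BoolFun n} (hf : IsBent f) :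
    ∃ f' : BoolFun n, IsBent f' ∧ walsh f' 0 = 1 / √((2 : ℝ) ^ n) := by
  rcases abs_choice (walsh f 0) with h | h
  · exact ⟨f, hf, h ▸ hf 0⟩
  · refine ⟨fun x => f x + 1, fun a => ?_, ?_⟩
    · rw [walsh_add_one, abs_neg, hf a]
    · rw [walsh_add_one, ← h, hf 0]

/-- The difference of two values of the form 1 - 2d/2ⁿ is 4λ, so 2λ2ⁿ is an integer; no coefficient
exceeds 1, which bounds it by the weight. -/
theorem exists_flip_count {n : ℕ} {lam : ℝ} (hlam : 0 < lam) {f g : BoolFun n}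
    (hf0 : walsh f 0 = 1 / √((2 : ℝ) ^ n))
    (hg : walshMax g = 1 / √((2 : ℝ) ^ n) + 4 * lam) :
    ∃ k : ℕ, (k : ℝ) = 2 * lam * 2 ^ n ∧ k ≤ weight f := by
  obtain ⟨a, ha⟩ := exists_abs_walsh_eq_walshMax g
  obtain ⟨d, hd⟩ := exists_abs_walsh_eq g a
  have hle := abs_walsh_le_one g a
  have hw := walsh_zero_eq_one_sub_weight f
  have hN : (0 : ℝ) < 2 ^ n := by positivity
  rw [← ha, hg, ← hf0, hw] at hd hle
  have hkd : 2 * lam * 2 ^ n = ((weight f - d : ℤ) : ℝ) := by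
    push_cast
    field_simp at hd
    linarith
  have hpos : (0 : ℤ) ≤ weight f - d := by
    have : (0 : ℝ) ≤ ((weight f - d : ℤ) : ℝ) := hkd ▸ by positivity
    exact_mod_cast this
  obtain ⟨k, hk⟩ := Int.eq_ofNat_of_zero_le hpos
  have hk' : (k : ℝ) = 2 * lam * 2 ^ n := by
    rw [hkd, hk]
    simp
  refine ⟨k, hk', ?_⟩
  have : (k : ℝ) ≤ weight f := by
    rw [hk']
    have : 4 * lam ≤ 2 * (weight f : ℝ) / 2 ^ n := by linarith
    rw [le_div_iff₀ hN] at this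
    linarith
  exact_mod_cast this

/-! ### Small sums over subsets -/

/-- Averaging: discarding a heaviest element never raises the mean weight. -/
theorem exists_subset_card_sum_le {α : Type*} (s : Finset α) (w : α → ℝ) {k : ℕ}
    (hk : k ≤ s.card) :
    ∃ t ⊆ s, t.card = k ∧ (s.card : ℝ) * ∑ x ∈ t, w x ≤ k * ∑ x ∈ s, w x := by
  induction hk using Nat.decreasingInduction with
  | self => exact ⟨s, subset_rfl, rfl, le_rfl⟩
  | of_succ k hk ih =>
    obtain ⟨t, hts, htc, hsum⟩ := ih
    have hne : t.Nonempty := by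
      rw [← Finset.card_pos]
      omega
    obtain ⟨x, hx, hmax⟩ := t.exists_max_image w hne
    have hcard : (t.erase x).card = k := by
      rw [Finset.card_erase_of_mem hx]
      omega
    refine ⟨t.erase x, (t.erase_subset x).trans hts, hcard, ?_⟩
    have h1 : ∑ y ∈ t.erase x, w y ≤ k * w x := by
      have := Finset.sum_le_card_nsmul (t.erase x) w (w x)
        fun y hy => hmax y (Finset.mem_of_mem_erase hy)
      rwa [hcard, nsmul_eq_mul] at this
    have h2 := Finset.sum_erase_add t w hx
    rw [← h2] at hsum
    push_cast at hsum
    have hs : (0 : ℝ) ≤ s.card := by positivity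
    have h3 : ((k : ℝ) + 1) * ∑ y ∈ t.erase x, w y ≤ k * (∑ y ∈ t.erase x, w y + w x) := by
      linarith
    have h4 : ((k : ℝ) + 1) * ((s.card : ℝ) * ∑ y ∈ t.erase x, w y) ≤
        (k + 1) * (k * ∑ x ∈ s, w x) := by
      calc ((k : ℝ) + 1) * ((s.card : ℝ) * ∑ y ∈ t.erase x, w y)
          = s.card * ((k + 1) * ∑ y ∈ t.erase x, w y) := by ring
        _ ≤ s.card * (k * (∑ y ∈ t.erase x, w y + w x)) := by gcongr
        _ = k * (s.card * (∑ y ∈ t.erase x, w y + w x)) := by ring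
        _ ≤ k * ((k + 1) * ∑ x ∈ s, w x) := by gcongr
        _ = _ := by ring
    exact le_of_mul_le_mul_left h4 (by positivity)

/-! ### Query masses and the hybrid argument -/

/-- The squared norm of the part of a state that queries the point `x`. -/
def queryMass {n : ℕ} {W : Type} [Fintype W] (v : EuclideanSpace ℂ (Cube n × ZMod 2 × W))
    (x : Cube n) : ℝ :=
  ∑ p : ZMod 2 × W, ‖v (x, p)‖ ^ 2

theorem sum_queryMass {n : ℕ} {W : Type} [Fintype W]
    (v : EuclideanSpace ℂ (Cube n × ZMod 2 × W)) : ∑ x, queryMass v x = ‖v‖ ^ 2 := by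
  rw [EuclideanSpace.norm_sq_eq, Fintype.sum_prod_type]
  rfl

theorem queryMass_nonneg {n : ℕ} {W : Type} [Fintype W]
    (v : EuclideanSpace ℂ (Cube n × ZMod 2 × W)) (x : Cube n) : 0 ≤ queryMass v x :=
  Finset.sum_nonneg fun _ _ => by positivity

theorem oracle_apply {n : ℕ} {W : Type} [Fintype W] (f : BoolFun n)
    (v : EuclideanSpace ℂ (Cube n × ZMod 2 × W)) (z : Cube n × ZMod 2 × W) :
    oracle W f v z = v (z.1, z.2.1 - f z.1, z.2.2) := rfl

theorem queryMass_oracle {n : ℕ} {W : Type} [Fintype W] (f : BoolFun n)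
    (v : EuclideanSpace ℂ (Cube n × ZMod 2 × W)) (x : Cube n) :
    queryMass (oracle W f v) x = queryMass v x := by
  simp only [queryMass, oracle_apply, Fintype.sum_prod_type]
  exact Equiv.sum_comp (Equiv.subRight (f x)) fun b => ∑ w, ‖v (x, b, w)‖ ^ 2

theorem norm_oracle_sub_oracle_sq_le {n : ℕ} {W : Type} [Fintype W] {f g : BoolFun n}
    {S : Finset (Cube n)} (h : ∀ x, x ∉ S → g x = f x)
    (v : EuclideanSpace ℂ (Cube n × ZMod 2 × W)) :
    ‖oracle W g v - oracle W f v‖ ^ 2 ≤ 4 * ∑ x ∈ S, queryMass v x := by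
  rw [← sum_queryMass, ← Finset.sum_subset (Finset.subset_univ S), Finset.mul_sum]
  · refine Finset.sum_le_sum fun x _ => ?_
    -- Both oracles preserve the mass at x, so ‖a - b‖² ≤ 2‖a‖² + 2‖b‖² gives the factor 4.
    have h4 : 4 * queryMass v x =
        2 * queryMass (oracle W g v) x + 2 * queryMass (oracle W f v) x := by
      rw [queryMass_oracle, queryMass_oracle]
      ring
    rw [h4]
    simp only [queryMass, Finset.mul_sum, ← Finset.sum_add_distrib]
    refine Finset.sum_le_sum fun p _ => ?_
    have h1 : ‖(oracle W g v - oracle W f v) (x, p)‖ ≤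
        ‖oracle W g v (x, p)‖ + ‖oracle W f v (x, p)‖ := norm_sub_le _ _
    have h2 := norm_nonneg ((oracle W g v - oracle W f v) (x, p))
    nlinarith [sq_nonneg (‖oracle W g v (x, p)‖ - ‖oracle W f v (x, p)‖)]
  · intro x _ hx
    refine Finset.sum_eq_zero fun p _ => ?_
    rw [PiLp.sub_apply, oracle_apply, oracle_apply]
    simp [h x hx]

namespace QueryAlgorithm

variable {n : ℕ} (A : QueryAlgorithm n)

theorem norm_state (f : BoolFun n) (j : ℕ) : ‖A.state f j‖ = 1 := by
  induction j with
  | zero => simp [state]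
  | succ j ih => rw [state, LinearIsometryEquiv.norm_map, LinearIsometryEquiv.norm_map, ih]

/-- Isometries carry earlier errors along unchanged. Only states of the run on f appear on the
right, so g may be chosen after inspecting that run. -/
theorem norm_state_sub_le (f g : BoolFun n) (j : ℕ) :
    ‖A.state g j - A.state f j‖ ≤
      ∑ i ∈ Finset.range j, ‖oracle A.W g (A.state f i) - oracle A.W f (A.state f i)‖ := by
  induction j with
  | zero => simp [state]
  | succ j ih =>
    rw [Finset.sum_range_succ, state, state, ← map_sub, LinearIsometryEquiv.norm_map]
    calc ‖oracle A.W g (A.state g j) - oracle A.W f (A.state f j)‖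
        = ‖oracle A.W g (A.state g j - A.state f j) +
            (oracle A.W g (A.state f j) - oracle A.W f (A.state f j))‖ := by
          rw [map_sub]
          congr 1
          abel
      _ ≤ ‖oracle A.W g (A.state g j - A.state f j)‖ +
            ‖oracle A.W g (A.state f j) - oracle A.W f (A.state f j)‖ := norm_add_le _ _
      _ ≤ _ := by
          rw [LinearIsometryEquiv.norm_map]
          gcongr

theorem norm_state_sub_sq_le {f g : BoolFun n} {S : Finset (Cube n)}
    (h : ∀ x, x ∉ S → g x = f x) (j : ℕ) :
    ‖A.state g j - A.state f j‖ ^ 2 ≤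
      4 * j * ∑ x ∈ S, ∑ i ∈ Finset.range j, queryMass (A.state f i) x := by
  calc ‖A.state g j - A.state f j‖ ^ 2
      ≤ (∑ i ∈ Finset.range j,
          ‖oracle A.W g (A.state f i) - oracle A.W f (A.state f i)‖) ^ 2 := by
        gcongr
        exact A.norm_state_sub_le f g j
    _ ≤ j * ∑ i ∈ Finset.range j,
          ‖oracle A.W g (A.state f i) - oracle A.W f (A.state f i)‖ ^ 2 := by
        simpa using sq_sum_le_card_mul_sum_sq (s := Finset.range j)
          (f := fun i => ‖oracle A.W g (A.state f i) - oracle A.W f (A.state f i)‖)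
    _ ≤ j * ∑ i ∈ Finset.range j, 4 * ∑ x ∈ S, queryMass (A.state f i) x := by
        gcongr
        exact norm_oracle_sub_oracle_sq_le h _
    _ = _ := by
        rw [← Finset.mul_sum, Finset.sum_comm]
        ring

theorem prob_false_add_prob_true (f : BoolFun n) : A.prob f false + A.prob f true = 1 := by
  have h := Finset.sum_filter_add_sum_filter_not Finset.univ (fun z => A.output z = false)
    (fun z => ‖A.state f A.queries z‖ ^ 2)
  rw [← EuclideanSpace.norm_sq_eq, norm_state, one_pow] at h
  simpa [prob] using h

end QueryAlgorithm

/-! ### Measurement probabilities and the query lower bound -/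

/-- The restriction of a vector to a set of coordinates. -/
def restrictCoords {ι : Type*} [Fintype ι] (p : ι → Prop) (v : EuclideanSpace ℂ ι) :
    EuclideanSpace ℂ ι :=
  WithLp.toLp 2 fun i => if p i then v i else 0

theorem norm_restrictCoords_sq {ι : Type*} [Fintype ι] (p : ι → Prop)
    (v : EuclideanSpace ℂ ι) :
    ‖restrictCoords p v‖ ^ 2 = ∑ i ∈ Finset.univ.filter p, ‖v i‖ ^ 2 := by
  rw [EuclideanSpace.norm_sq_eq, Finset.sum_filter]
  refine Finset.sum_congr rfl fun i _ => ?_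
  by_cases h : p i <;> simp [restrictCoords, h]

theorem norm_restrictCoords_le {ι : Type*} [Fintype ι] (p : ι → Prop)
    (v : EuclideanSpace ℂ ι) : ‖restrictCoords p v‖ ≤ ‖v‖ := by
  rw [← sq_le_sq₀ (norm_nonneg _) (norm_nonneg _), norm_restrictCoords_sq,
    EuclideanSpace.norm_sq_eq]
  exact Finset.sum_le_sum_of_subset_of_nonneg (Finset.filter_subset _ _)
    fun _ _ _ => by positivity

theorem restrictCoords_sub {ι : Type*} [Fintype ι] (p : ι → Prop)
    (u v : EuclideanSpace ℂ ι) :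
    restrictCoords p (u - v) = restrictCoords p u - restrictCoords p v := by
  ext i
  by_cases h : p i <;> simp [restrictCoords, h]

theorem QueryAlgorithm.prob_sub_prob_le {n : ℕ} (A : QueryAlgorithm n) (f g : BoolFun n)
    (b : Bool) :
    A.prob g b - A.prob f b ≤ 2 * ‖A.state g A.queries - A.state f A.queries‖ := by
  set P : EuclideanSpace ℂ (Cube n × ZMod 2 × A.W) → EuclideanSpace ℂ (Cube n × ZMod 2 × A.W) :=
    restrictCoords fun z => A.output z = b
  have hprob : ∀ h, A.prob h b = ‖P (A.state h A.queries)‖ ^ 2 := fun h => by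
    rw [norm_restrictCoords_sq, QueryAlgorithm.prob]
    congr!
  have hle : ∀ h, ‖P (A.state h A.queries)‖ ≤ 1 := fun h =>
    (norm_restrictCoords_le _ _).trans (A.norm_state h _).le
  have hsub : ‖P (A.state g A.queries)‖ - ‖P (A.state f A.queries)‖ ≤
      ‖A.state g A.queries - A.state f A.queries‖ :=
    (norm_sub_norm_le _ _).trans <| by
      rw [← restrictCoords_sub]
      exact norm_restrictCoords_le _ _
  rw [hprob, hprob]
  have hg := hle g
  have hf := hle f
  have hg0 := norm_nonneg (P (A.state g A.queries))
  have hf0 := norm_nonneg (P (A.state f A.queries))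
  have hd := norm_nonneg (A.state g A.queries - A.state f A.queries)
  -- a² - b² = (a + b)(a - b), where a + b ≤ 2.
  nlinarith

/-- Distinguishing `f` from all functions obtained by erasing `k` of its ones takes
`Ω(√(weight f / k))` queries. -/
theorem QueryAlgorithm.Decides.sq_mul_weight_le {n : ℕ} {A : QueryAlgorithm n} {ε : ℝ}
    (hε : ε < 1 / 2) {f : BoolFun n} {k : ℕ} (hk : k ≤ weight f)
    (hA : A.Decides ε {f} (flips f k)) :
    (1 - 2 * ε) ^ 2 * weight f ≤ 16 * k * (A.queries : ℝ) ^ 2 := by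
  set T := A.queries with hT
  set w : Cube n → ℝ := fun x => ∑ i ∈ Finset.range T, queryMass (A.state f i) x with hw
  obtain ⟨S, hS, hc, hsum⟩ := exists_subset_card_sum_le
    (Finset.univ.filter fun x : Cube n => f x = 1) w hk
  set g : BoolFun n := fun x => if x ∈ S then 0 else f x with hg
  have hgf : ∀ x, x ∉ S → g x = f x := fun x hx => if_neg hx
  have hgmem : g ∈ flips f k :=
    ⟨S, hc, fun x hx => (Finset.mem_filter.mp (hS hx)).2, fun x => rfl⟩
  have hpf := hA.1 f rfl
  have hpg := hA.2 g hgmem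
  have hadd := A.prob_false_add_prob_true f
  have hdiff := A.prob_sub_prob_le f g false
  have hdist := A.norm_state_sub_sq_le hgf T
  have htotal : ∑ x ∈ Finset.univ.filter (fun x : Cube n => f x = 1), w x ≤ T := by
    calc ∑ x ∈ Finset.univ.filter (fun x : Cube n => f x = 1), w x ≤ ∑ x, w x :=
          Finset.sum_le_sum_of_subset_of_nonneg (Finset.filter_subset _ _)
            fun x _ _ => Finset.sum_nonneg fun i _ => queryMass_nonneg _ _
      _ = T := by
          rw [hw, Finset.sum_comm]
          simp [sum_queryMass, A.norm_state]
  -- The answer `false` has probability at least 1 - ε on g and at most ε on f.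
  have hgap : 1 - 2 * ε ≤ 2 * ‖A.state g T - A.state f T‖ := by linarith
  have hM : (0 : ℝ) ≤ weight f := by positivity
  calc (1 - 2 * ε) ^ 2 * weight f ≤ (2 * ‖A.state g T - A.state f T‖) ^ 2 * weight f := by
        gcongr
        linarith
    _ = 4 * weight f * ‖A.state g T - A.state f T‖ ^ 2 := by ring
    _ ≤ 4 * weight f * (4 * T * ∑ x ∈ S, w x) := by gcongr
    _ = 16 * T * (weight f * ∑ x ∈ S, w x) := by ring
    _ ≤ 16 * T * (k * ∑ x ∈ Finset.univ.filter (fun x : Cube n => f x = 1), w x) :=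
        mul_le_mul_of_nonneg_left hsum (by positivity)
    _ ≤ 16 * T * (k * T) := by gcongr
    _ = 16 * k * (T : ℝ) ^ 2 := by ring

/-- The weight is 2ⁿ(1 - 2^(-n/2))/2. It vanishes for n = 0; for n ≥ 1 the rational bound 4/3 < √2
suffices. -/
theorem pow_le_eight_mul_weight {n : ℕ} {f : BoolFun n} (hf0 : walsh f 0 = 1 / √((2 : ℝ) ^ n))
    (hpos : 0 < weight f) : (2 : ℝ) ^ n ≤ 8 * weight f := by
  have hw := walsh_zero_eq_one_sub_weight f
  rw [hf0] at hw
  have hN : (0 : ℝ) < 2 ^ n := by positivity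
  rcases Nat.eq_zero_or_pos n with rfl | hn
  · exfalso
    have : (0 : ℝ) < weight f := by exact_mod_cast hpos
    norm_num at hw
    linarith
  · have h2 : (4 / 3 : ℝ) ≤ √((2 : ℝ) ^ n) := by
      apply Real.le_sqrt_of_sq_le
      calc (4 / 3 : ℝ) ^ 2 ≤ 2 ^ 1 := by norm_num
        _ ≤ 2 ^ n := pow_le_pow_right₀ (by norm_num) hn
    have h3 : 1 / √((2 : ℝ) ^ n) ≤ 3 / 4 := by
      rw [div_le_iff₀ (by linarith)]
      linarith
    have h4 : (1 / 4 : ℝ) ≤ 2 * (weight f : ℝ) / 2 ^ n := by linarith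
    rw [le_div_iff₀ hN] at h4
    linarith

theorem QueryAlgorithm.Decides.div_sqrt_le_queries {n : ℕ} {A : QueryAlgorithm n} {ε lam : ℝ}
    (hε : ε < 1 / 2) (hlam : 0 < lam) {f : BoolFun n} {k : ℕ}
    (hf0 : walsh f 0 = 1 / √((2 : ℝ) ^ n)) (hk : (k : ℝ) = 2 * lam * 2 ^ n)
    (hkw : k ≤ weight f) (hA : A.Decides ε {f} (flips f k)) :
    (1 - 2 * ε) / 16 / √lam ≤ A.queries := by
  have hN : (0 : ℝ) < 2 ^ n := by positivity
  have hk0 : 0 < k := by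
    have : (0 : ℝ) < k := hk ▸ by positivity
    exact_mod_cast this
  have h1 := hA.sq_mul_weight_le hε hkw
  have h2 := pow_le_eight_mul_weight hf0 (hk0.trans_le hkw)
  have hs := Real.sqrt_pos.mpr hlam
  rw [div_le_iff₀ hs]
  refine le_of_sq_le_sq ?_ (by positivity)
  rw [mul_pow, Real.sq_sqrt hlam.le]
  have h3 : (1 - 2 * ε) ^ 2 * 2 ^ n ≤ 256 * ((A.queries : ℝ) ^ 2 * lam) * 2 ^ n := by
    calc (1 - 2 * ε) ^ 2 * 2 ^ n ≤ (1 - 2 * ε) ^ 2 * (8 * weight f) := by gcongr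
      _ = 8 * ((1 - 2 * ε) ^ 2 * weight f) := by ring
      _ ≤ 8 * (16 * k * (A.queries : ℝ) ^ 2) := by gcongr
      _ = 256 * ((A.queries : ℝ) ^ 2 * lam) * 2 ^ n := by rw [hk]; ring
  have h4 := le_of_mul_le_mul_right h3 hN
  rw [div_pow]
  linarith

end

theorem theorem6p4 :
    -- the first case of the promise describes the bent functions
    (∀ (n : ℕ) (f : BoolFun n), walshMax f = 1 / √((2 : ℝ) ^ n) ↔ IsBent f) ∧
    -- the bent functions used for the hard instances exist for every even `n`
    (∀ n : ℕ, Even n → ∃ f : BoolFun n, IsBent f ∧ walsh f 0 = 1 / √((2 : ℝ) ^ n)) ∧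
    -- flipping `2 lam 2ⁿ` ones of such a function to zero gives the second case of the promise
    (∀ (n : ℕ) (lam : ℝ) (f : BoolFun n) (k : ℕ), 0 < lam → IsBent f →
      walsh f 0 = 1 / √((2 : ℝ) ^ n) → (k : ℝ) = 2 * lam * 2 ^ n → k ≤ weight f →
        (flips f k).Nonempty ∧
        ∀ g ∈ flips f k, walshMax g = 1 / √((2 : ℝ) ^ n) + 4 * lam) ∧
    -- the lower bound, with a constant that depends on the allowed error probability only
    (∀ ε : ℝ, 0 ≤ ε → ε < 1 / 2 → ∃ c : ℝ, 0 < c ∧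
      -- for the decision problem, whenever both cases can occur
      (∀ (n : ℕ) (lam : ℝ), 0 < lam →
        (∃ f : BoolFun n, walshMax f = 1 / √((2 : ℝ) ^ n)) →
        (∃ g : BoolFun n, walshMax g = 1 / √((2 : ℝ) ^ n) + 4 * lam) →
        ∀ A : QueryAlgorithm n,
          A.Decides ε {f | walshMax f = 1 / √((2 : ℝ) ^ n)}
            {g | walshMax g = 1 / √((2 : ℝ) ^ n) + 4 * lam} →
          c / √lam ≤ (A.queries : ℝ)) ∧
      -- already for the hard instances
      (∀ (n : ℕ) (lam : ℝ) (f : BoolFun n) (k : ℕ), 0 < lam → IsBent f →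
        walsh f 0 = 1 / √((2 : ℝ) ^ n) → (k : ℝ) = 2 * lam * 2 ^ n → k ≤ weight f →
        ∀ A : QueryAlgorithm n, A.Decides ε {f} (flips f k) →
          c / √lam ≤ (A.queries : ℝ))) := by
  refine ⟨fun n f => walshMax_eq_iff_isBent f, fun n hn => exists_isBent_of_even hn,
    fun n lam f k _ hf hf0 hk hkw =>
      ⟨flips_nonempty f hkw, fun g hg => walshMax_of_mem_flips hf hf0 hk hg⟩,
    fun ε _ hε => ⟨(1 - 2 * ε) / 16, by linarith, ?_, ?_⟩⟩
  · rintro n lam hlam ⟨f, hf⟩ ⟨g, hg⟩ A hA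
    -- Complementing f if necessary makes its coefficient at 0 positive; the flips of `f'` then
    -- satisfy the second promise.
    obtain ⟨f', hf', hf0⟩ := ((walshMax_eq_iff_isBent f).mp hf).exists_walsh_zero
    obtain ⟨k, hk, hkw⟩ := exists_flip_count hlam hf0 hg
    refine QueryAlgorithm.Decides.div_sqrt_le_queries hε hlam hf0 hk hkw ⟨?_, ?_⟩
    · rintro _ rfl
      exact hA.1 _ ((walshMax_eq_iff_isBent _).mpr hf')
    · exact fun g hg => hA.2 g (walshMax_of_mem_flips hf' hf0 hk hg)
  · intro n lam f k hlam _ hf0 hk hkw A hA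
    exact hA.div_sqrt_le_queries hε hlam hf0 hk hkw
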